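/- Let $n\to\infty$, let $m=m_n$ and $s_n$ be positive integers such that, for some fixed $v_1\in(0,1)$, $1\le s_n\le n^{v_1}$ for all large $n$, and $(\log n)^2/m\to 0$. For $\theta\in[0,1]^n$ let $X_1,\dots,X_n$ be independent with $X_j\sim\mathrm{Bin}(m,\theta_j)$, write $X=(X_1,\dots,X_n)$ and $S_\theta=\{j:\theta_j\ne 1/2\}$. Put $\zeta_n=\sqrt{\tfrac{1}{2m}\log(n/s_n)}$ and, for $a>0$ and $d\ge 0$, $$\Theta_0[s_n,a]=\{\theta\in[0,1]^n:\ |S_\theta|=s_n,\ |\theta_j-\tfrac12|\ge a\,\zeta_n\ \ \forall j\in S_\theta\},$$ $$\Theta_0^-[s_n;d]=\{\theta\in[0,1]^n:\ |S_\theta|=s_n,\ |\theta_j-\tfrac12|\le d\ \ \forall j\in S_\theta\}.$$ Let $\mathcal T$ be the class of all thresholding-based procedures $\mathsf T=(\mathsf T_1,\dots,\mathsf T_n)$, $$\mathsf T_j=\mathbf 1\{X_j-m/2\ge m\tau_1(X)\ \text{ or }\ X_j-m/2\le -m\tau_2(X)\},\qquad 1\le j\le n,$$ where $\tau_1,\tau_2$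 are arbitrary measurable real-valued functions of the data $X$ (the same for all $j$). Let $\mathfrak R(\theta,\mathsf T)=\mathrm{FDR}(\theta,\mathsf T)+\mathrm{FNR}(\theta,\mathsf T)$ with $$\mathrm{FDR}(\theta,\mathsf T)=\mathbb E_\theta\frac{\sum_{j}\mathbf 1\{\theta_j=1/2\}\mathsf T_j}{1\vee\sum_j\mathsf T_j},\qquad \mathrm{FNR}(\theta,\mathsf T)=\mathbb E_\theta\frac{\sum_{j}\mathbf 1\{\theta_j\ne1/2\}(1-\mathsf T_j)}{1\vee\sum_j\mathbf 1\{\theta_j\ne1/2\}}.$$ Then for every $0<a<1$, $$\liminf_{n\to\infty}\ \inf_{\mathsf T\in\mathcal T}\ \sup_{\theta_0\in\Theta_0[s_n,a]}\mathfrak R(\theta_0,\mathsf T)\ \ge\ 1 \qquad\text{and}\qquad \liminf_{n\to\infty}\ \inf_{\mathsf T\in\mathcal T}\ \inf_{\theta_0\in\Theta_0^-[s_n;\,a\zeta_n]}\mathfrak R(\theta_0,\mathsf T)\ \ge\ 1 .$$ -/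

import Mathlib

open MeasureTheory ProbabilityTheory Filter Asymptotics
open scoped Topology

noncomputable section

namespace BernoulliSequence

/-- The law of the vector of counts `X = (X₁, …, Xₙ)`, where the `X_j` are independent and
`X_j ∼ Bin(m, θ_j)`. -/
def law (n m : ℕ) (θ : Fin n → unitInterval) : Measure (Fin n → ℕ) :=
  Measure.pi fun j => ProbabilityTheory.binomial m (θ j)

open Classical in
/-- The support `S_θ = {j : θ_j ≠ 1/2}` (the false null hypotheses). -/
def support {n : ℕ} (θ : Fin n → unitInterval) : Finset (Fin n) :=
  Finset.univ.filter fun j => (θ j : ℝ) ≠ 1 / 2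

/-- The sparse class `ℓ₀[s]`: at most `s` coordinates differ from `1/2`. -/
def sparseClass (n s : ℕ) : Set (Fin n → unitInterval) :=
  {θ | (support θ).card ≤ s}

/-- `ζ(w) = √((1 / (2m)) log (1 / w))`. -/
def zeta (m : ℕ) (w : ℝ) : ℝ :=
  Real.sqrt (1 / (2 * (m : ℝ)) * Real.log (1 / w))

/-- The class `Θ₀[s, a]` of large signals: exactly `s` coordinates differ from `1/2`, and each
of them is at distance at least `a ζ(s/n)` from `1/2`. -/
def largeSignals (n m s : ℕ) (a : ℝ) : Set (Fin n → unitInterval) :=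
  {θ | θ ∈ sparseClass n s ∧
    (∀ j ∈ support θ, a * zeta m ((s : ℝ) / n) ≤ |(θ j : ℝ) - 1 / 2|) ∧
    (support θ).card = s}

/-- The class `Θ₀⁻[s; d]` of small signals: exactly `s` coordinates differ from `1/2`, and each
of them is at distance at most `d` from `1/2`. -/
def smallSignals (n s : ℕ) (d : ℝ) : Set (Fin n → unitInterval) :=
  {θ | θ ∈ sparseClass n s ∧
    (∀ j ∈ support θ, |(θ j : ℝ) - 1 / 2| ≤ d) ∧
    (support θ).card = s}

/-- A thresholding-based multiple testing procedure for `n` hypotheses: an upper and a lower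
threshold, common to all coordinates, which may depend on the whole data vector. -/
structure ThresholdingProcedure (n : ℕ) where
  τ₁ : (Fin n → ℕ) → ℝ
  τ₂ : (Fin n → ℕ) → ℝ
  measurable_τ₁ : Measurable τ₁
  measurable_τ₂ : Measurable τ₂

open Classical in
/-- The set of rejected hypotheses: `T_j(X) = 1` if and only if
`X_j - m/2 ≥ m τ₁(X)` or `X_j - m/2 ≤ -m τ₂(X)`. -/
def ThresholdingProcedure.rejected {n : ℕ} (T : ThresholdingProcedure n) (m : ℕ)
    (X : Fin n → ℕ) : Finset (Fin n) :=
  Finset.univ.filter fun j =>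
    (X j : ℝ) - (m : ℝ) / 2 ≥ (m : ℝ) * T.τ₁ X ∨ (X j : ℝ) - (m : ℝ) / 2 ≤ -((m : ℝ) * T.τ₂ X)

/-- False discovery proportion of a set `R` of rejected hypotheses. -/
def fdp {n : ℕ} (θ : Fin n → unitInterval) (R : Finset (Fin n)) : ℝ :=
  ((R \ support θ).card : ℝ) / max 1 (R.card : ℝ)

/-- False negative proportion of a set `R` of rejected hypotheses. -/
def fnp {n : ℕ} (θ : Fin n → unitInterval) (R : Finset (Fin n)) : ℝ :=
  ((support θ \ R).card : ℝ) / max 1 ((support θ).card : ℝ)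

/-- False discovery rate `E_θ FDP`. -/
def fdr {n : ℕ} (m : ℕ) (θ : Fin n → unitInterval) (T : ThresholdingProcedure n) : ℝ :=
  ∫ X, fdp θ (T.rejected m X) ∂(law n m θ)

/-- False negative rate `E_θ FNP`. -/
def fnr {n : ℕ} (m : ℕ) (θ : Fin n → unitInterval) (T : ThresholdingProcedure n) : ℝ :=
  ∫ X, fnp θ (T.rejected m X) ∂(law n m θ)

/-- The multiple testing risk `FDR + FNR`. -/
def risk {n : ℕ} (m : ℕ) (θ : Fin n → unitInterval) (T : ThresholdingProcedure n) : ℝ :=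
  fdr m θ T + fnr m θ T

end BernoulliSequence

end

/-! Fix `a < b < 1`, write `L = log (n / s)` and `ζ² = L / (2m)`, and compare every procedure with
the single level `u = m b ζ` on both sides of `m / 2`. A signal within `a ζ` of `1/2` crosses `u`
with probability `O(1 / L)`, so Chebyshev makes the share of crossing signals small. A null crosses
`u` on a given side with probability at least `(3/4) exp (-κ L)` for some `κ < 1`, so about `s exp
((1 - κ) L)` nulls cross it, many more than `s`.

On the event where both hold, a data-dependent threshold does not help. If one of the two thresholds
is at most `u`, all nulls beyond `u` on that side are rejected and the FDP is near 1. Otherwise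
rejected signals must themselves lie beyond `u`, and the FNP is near 1. This is `fdp_add_fnp_ge`,
integrated in `risk_ge`. The moderate deviation bound `binomial_half_tail_ge` comes from a change of
measure, and `exists_risk_ge` fixes the constants.

The resulting bound is uniform over small signals. The supremum over large signals follows, because
a configuration at distance exactly `a ζ` belongs to both classes. -/

/-! ### Tail bounds for binomial laws. -/

/-- Second central moment of the binomial distribution. -/
lemma integral_sq_sub_mean_binomial (m : ℕ) (p : unitInterval) :
    ∫ k, ((k : ℝ) - m * p) ^ 2 ∂(binomial m p) = m * p * (1 - p) := by
  rw [integral_binomial]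
  have h := congrArg (Polynomial.eval (p : ℝ)) (bernsteinPolynomial.variance ℝ m)
  simp only [bernsteinPolynomial, Polynomial.eval_finsetSum, nsmul_eq_mul] at h
  simp only [Polynomial.eval_mul, Polynomial.eval_pow, Polynomial.eval_sub, Polynomial.eval_X,
    Polynomial.eval_natCast, Polynomial.eval_one] at h
  rw [← h, Nat.range_succ_eq_Iic]
  refine Finset.sum_congr rfl fun k _ => ?_
  rw [smul_eq_mul]; ring

lemma binomial_real_le_abs_sub_mean (m : ℕ) (p : unitInterval) {c : ℝ} (hc : 0 < c) :
    (binomial m p).real {k | c ≤ |(k : ℝ) - m * p|} ≤ m / (4 * c ^ 2) := by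
  have h := mul_meas_ge_le_integral_of_nonneg (μ := binomial m p)
    (f := fun k : ℕ => ((k : ℝ) - m * p) ^ 2) (Eventually.of_forall fun k => sq_nonneg _)
    (integrable_binomial _) (c ^ 2)
  rw [integral_sq_sub_mean_binomial] at h
  have hset : {k : ℕ | c ^ 2 ≤ ((k : ℝ) - m * p) ^ 2} = {k : ℕ | c ≤ |(k : ℝ) - m * p|} := by
    ext k
    simp only [Set.mem_ofPred_eq]
    rw [← sq_abs ((k : ℝ) - m * p)]
    exact sq_le_sq₀ hc.le (abs_nonneg _)
  rw [hset] at h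
  rw [le_div_iff₀ (by positivity)]
  have h4 : (m : ℝ) * p * (1 - p) ≤ m / 4 := by
    nlinarith [mul_nonneg (Nat.cast_nonneg (α := ℝ) m) (sq_nonneg ((p : ℝ) - 1 / 2))]
  linarith

/-- The logarithm is the half sum of `log (1 ± u)` times `i + j` plus their half difference times `j
- i`. The sum is `log (1 - u²)`, and `log t ≤ t - 1` bounds both parts. This controls the likelihood
ratio in the tilting step. -/
lemma one_add_pow_mul_one_sub_pow_le {u y : ℝ} (hu : 0 ≤ u) (hu1 : u < 1) (hy : 0 ≤ y)
    {i j : ℕ} (hij : (j : ℝ) - i ≤ 2 * y) :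
    (1 + u) ^ j * (1 - u) ^ i ≤
      Real.exp (-(((i : ℝ) + j) * u ^ 2 / 2) + 2 * y * u / (1 - u)) := by
  have h1 : 0 < 1 - u := by linarith
  have h2 : 0 < 1 + u := by linarith
  have hpos : 0 < (1 + u) ^ j * (1 - u) ^ i := by positivity
  rw [← Real.log_le_iff_le_exp hpos, Real.log_mul (by positivity) (by positivity), Real.log_pow,
    Real.log_pow]
  have hs : Real.log (1 + u) + Real.log (1 - u) ≤ -u ^ 2 := by
    rw [← Real.log_mul h2.ne' h1.ne']
    have := Real.log_le_sub_one_of_pos (mul_pos h2 h1)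
    nlinarith
  have hd : Real.log (1 + u) - Real.log (1 - u) ≤ 2 * u / (1 - u) := by
    rw [← Real.log_div h2.ne' h1.ne']
    refine (Real.log_le_sub_one_of_pos (by positivity)).trans (le_of_eq ?_)
    field_simp; ring
  have hd0 : 0 ≤ Real.log (1 + u) - Real.log (1 - u) :=
    sub_nonneg.2 (Real.log_le_log h1 (by linarith))
  have e1 : ((i : ℝ) + j) / 2 * (Real.log (1 + u) + Real.log (1 - u)) ≤
      ((i : ℝ) + j) / 2 * (-u ^ 2) := mul_le_mul_of_nonneg_left hs (by positivity)
  have e2 : ((j : ℝ) - i) / 2 * (Real.log (1 + u) - Real.log (1 - u)) ≤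
      y * (2 * u / (1 - u)) :=
    (mul_le_mul_of_nonneg_right (by linarith) hd0).trans (mul_le_mul_of_nonneg_left hd hy)
  have e3 : y * (2 * u / (1 - u)) = 2 * y * u / (1 - u) := by ring
  rw [e3] at e2
  linarith

/-- The point `1/2` of the unit interval. -/
noncomputable def unitHalf : unitInterval := ⟨1 / 2, by norm_num, by norm_num⟩

/-- Exponential change of measure from `Bin(m, 1/2)` to `Bin(m, 1/2 + σ x)`, `σ = ±1`. -/
lemma binomial_tilt_singleton_le {m k : ℕ} {σ x y : ℝ} (hσ : σ = 1 ∨ σ = -1) (hx : 0 ≤ x)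
    (hx2 : x < 1 / 2) (hy : 0 ≤ y) (hk : k ≤ m) (q : unitInterval)
    (hq : (q : ℝ) = 1 / 2 + σ * x) (hky : σ * ((k : ℝ) - m / 2) ≤ y) :
    (m.choose k : ℝ) * (q : ℝ) ^ k * (1 - q) ^ (m - k) ≤
      Real.exp (-(2 * m * x ^ 2) + 4 * y * x / (1 - 2 * x)) *
        ((m.choose k : ℝ) * (1 / 2) ^ k * (1 - 1 / 2) ^ (m - k)) := by
  have hpow : ((1 : ℝ) / 2) ^ k * (1 - 1 / 2) ^ (m - k) = (1 / 2) ^ m := by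
    rw [show (1 : ℝ) - 1 / 2 = 1 / 2 by norm_num, ← pow_add, Nat.add_sub_cancel' hk]
  have hsub : ((m - k : ℕ) : ℝ) = (m : ℝ) - k := Nat.cast_sub hk
  have key : (q : ℝ) ^ k * (1 - q) ^ (m - k) ≤
      Real.exp (-(2 * m * x ^ 2) + 4 * y * x / (1 - 2 * x)) * (1 / 2) ^ m := by
    rcases hσ with rfl | rfl
    · have h := one_add_pow_mul_one_sub_pow_le (u := 2 * x) (y := y) (by linarith) (by linarith)
        hy (i := m - k) (j := k) (by rw [hsub]; linarith)
      rw [hsub] at h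
      have e : (q : ℝ) ^ k * (1 - q) ^ (m - k) =
          ((1 + 2 * x) ^ k * (1 - 2 * x) ^ (m - k)) * (1 / 2) ^ m := by
        rw [hq, ← hpow, show (1 : ℝ) / 2 + 1 * x = (1 + 2 * x) * (1 / 2) by ring,
          show 1 - (1 + 2 * x) * (1 / 2) = (1 - 2 * x) * (1 - 1 / 2) by ring, mul_pow, mul_pow]
        ring
      rw [e]
      refine mul_le_mul_of_nonneg_right (h.trans (le_of_eq ?_)) (by positivity)
      congr 1; ring
    -- For the lower tail, successes and failures exchange roles.
    · have h := one_add_pow_mul_one_sub_pow_le (u := 2 * x) (y := y) (by linarith) (by linarith)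
        hy (i := k) (j := m - k) (by rw [hsub]; linarith)
      rw [hsub] at h
      have e : (q : ℝ) ^ k * (1 - q) ^ (m - k) =
          ((1 + 2 * x) ^ (m - k) * (1 - 2 * x) ^ k) * (1 / 2) ^ m := by
        rw [hq, ← hpow, show (1 : ℝ) / 2 + -1 * x = (1 - 2 * x) * (1 / 2) by ring,
          show 1 - (1 - 2 * x) * (1 / 2) = (1 + 2 * x) * (1 - 1 / 2) by ring, mul_pow, mul_pow]
        ring
      rw [e]
      refine mul_le_mul_of_nonneg_right (h.trans (le_of_eq ?_)) (by positivity)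
      congr 1; ring
  calc (m.choose k : ℝ) * (q : ℝ) ^ k * (1 - q) ^ (m - k)
      = m.choose k * ((q : ℝ) ^ k * (1 - q) ^ (m - k)) := by ring
    _ ≤ m.choose k * (Real.exp (-(2 * m * x ^ 2) + 4 * y * x / (1 - 2 * x)) * (1 / 2) ^ m) :=
        mul_le_mul_of_nonneg_left key (by positivity)
    _ = _ := by rw [← hpow]; ring

lemma binomial_real_eq_sum (m : ℕ) (p : unitInterval) (A : Set ℕ) :
    (binomial m p).real A = ∑ k ∈ Finset.Iic m,
      (m.choose k * (p : ℝ) ^ k * (1 - p) ^ (m - k)) * A.indicator (fun _ => 1) k := by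
  have h := integral_binomial (n := m) (p := p) (A.indicator fun _ => (1 : ℝ))
  rw [integral_indicator_const _ (MeasurableSet.of_discrete)] at h
  simpa using h

/-- Moderate deviation lower bound for both tails of `Bin(m, 1/2)`. -/
lemma binomial_half_tail_ge {m : ℕ} {σ x c : ℝ} (hσ : σ = 1 ∨ σ = -1) (hc : 0 < c)
    (hx : 0 ≤ x) (hx2 : x < 1 / 2) (hmc : 1 ≤ m * c ^ 2) :
    3 / 4 * Real.exp (-(m * (4 * (x + c) * x / (1 - 2 * x) - 2 * x ^ 2))) ≤
      (binomial m unitHalf).real {k | m * (x - c) ≤ σ * ((k : ℝ) - m / 2)} := by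
  have hm : (0 : ℝ) < m := by
    rcases (Nat.cast_nonneg (α := ℝ) m).eq_or_lt with h | h
    · rw [← h] at hmc; norm_num at hmc
    · exact h
  have hσ2 : σ * σ = 1 := by rcases hσ with rfl | rfl <;> norm_num
  have hσa : |σ| = 1 := by rcases hσ with rfl | rfl <;> norm_num
  -- Under the tilted parameter `q` the deviation `m x` is typical: Chebyshev with radius `m c`
  -- keeps mass at least `3/4`. The upper edge `m (x + c)` of this window bounds the likelihood
  -- ratio, and the lower edge places it inside the tail.
  let q : unitInterval := ⟨1 / 2 + σ * x, by
    rcases hσ with rfl | rfl <;> constructor <;> linarith⟩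
  have hq : (q : ℝ) = 1 / 2 + σ * x := rfl
  set B : Set ℕ := {k | m * c ≤ |(k : ℝ) - m * q|} with hB
  set E : ℝ := -(2 * m * x ^ 2) + 4 * (m * (x + c)) * x / (1 - 2 * x) with hE
  have hcheb : (binomial m q).real B ≤ 1 / 4 := by
    refine (binomial_real_le_abs_sub_mean m q (by positivity)).trans ?_
    rw [div_le_iff₀ (by positivity)]
    nlinarith
  have hcompl : 3 / 4 ≤ (binomial m q).real Bᶜ := by
    rw [probReal_compl_eq_one_sub (MeasurableSet.of_discrete)]; linarith
  have hmem : ∀ k ∈ Bᶜ, m * (x - c) ≤ σ * ((k : ℝ) - m / 2) ∧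
      σ * ((k : ℝ) - m / 2) ≤ m * (x + c) := by
    intro k hk
    have hk' : |σ * ((k : ℝ) - m * q)| < m * c := by
      rw [abs_mul, hσa, one_mul]; simpa [hB] using hk
    have e : σ * ((k : ℝ) - m / 2) = σ * ((k : ℝ) - m * q) + m * x := by
      rw [hq]; linear_combination ((m : ℝ) * x) * hσ2
    rw [abs_lt] at hk'
    constructor <;> rw [e] <;> linarith [hk'.1, hk'.2]
  have hle : (binomial m q).real Bᶜ ≤ Real.exp E * (binomial m unitHalf).real Bᶜ := by
    rw [binomial_real_eq_sum, binomial_real_eq_sum, Finset.mul_sum]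
    refine Finset.sum_le_sum fun k hk => ?_
    by_cases hkB : k ∈ Bᶜ
    · rw [Set.indicator_of_mem hkB, mul_one, mul_one]
      exact binomial_tilt_singleton_le hσ hx hx2 (by positivity) (Finset.mem_Iic.1 hk) q hq
        (hmem k hkB).2
    · simp [Set.indicator_of_notMem hkB]
  have hmono : (binomial m unitHalf).real Bᶜ ≤
      (binomial m unitHalf).real {k | m * (x - c) ≤ σ * ((k : ℝ) - m / 2)} :=
    measureReal_mono fun k hk => (hmem k hk).1
  have hEe : -(m * (4 * (x + c) * x / (1 - 2 * x) - 2 * x ^ 2)) = -E := by rw [hE]; ring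
  rw [hEe, Real.exp_neg, ← div_eq_mul_inv, div_le_iff₀ (Real.exp_pos _), mul_comm _ (Real.exp E)]
  exact hcompl.trans (hle.trans (mul_le_mul_of_nonneg_left hmono (Real.exp_pos _).le))

/-- Upper bound for both tails of a binomial distribution whose mean is close to `m / 2`. -/
lemma binomial_tail_le {m : ℕ} {σ d t : ℝ} (hσ : σ = 1 ∨ σ = -1) (hm : 0 < m) (hdt : d < t)
    (p : unitInterval) (hp : |(p : ℝ) - 1 / 2| ≤ d) :
    (binomial m p).real {k | m * t ≤ σ * ((k : ℝ) - m / 2)} ≤ 1 / (4 * (m * (t - d) ^ 2)) := by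
  have hm' : (0 : ℝ) < m := by exact_mod_cast hm
  have hσa : |σ| = 1 := by rcases hσ with rfl | rfl <;> norm_num
  have htd : 0 < t - d := by linarith
  refine (measureReal_mono (s₂ := {k : ℕ | m * (t - d) ≤ |(k : ℝ) - m * p|}) fun k hk => ?_).trans
    ((binomial_real_le_abs_sub_mean m p (c := m * (t - d)) (by positivity)).trans (le_of_eq ?_))
  · simp only [Set.mem_ofPred_eq] at hk ⊢
    have h1 : σ * ((k : ℝ) - m / 2) = σ * ((k : ℝ) - m * p) + m * (σ * (p - 1 / 2)) := by ring
    have h2 : σ * ((p : ℝ) - 1 / 2) ≤ d :=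
      (le_abs_self _).trans (by rw [abs_mul, hσa, one_mul]; exact hp)
    have h3 : σ * ((k : ℝ) - m * p) ≤ |(k : ℝ) - m * p| :=
      (le_abs_self _).trans (by rw [abs_mul, hσa, one_mul])
    nlinarith [mul_le_mul_of_nonneg_left h2 hm'.le]
  · field_simp

/-! ### Concentration of the number of exceedances. -/

namespace BernoulliSequence

instance (n m : ℕ) (θ : Fin n → unitInterval) : IsProbabilityMeasure (law n m θ) := by
  unfold law; infer_instance

open Classical in
/-- Number of coordinates in `S` whose observation falls into `A`. -/
noncomputable def hits {n : ℕ} (S : Finset (Fin n)) (A : Set ℕ) (X : Fin n → ℕ) : ℝ :=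
  ((S.filter fun j => X j ∈ A).card : ℝ)

lemma hits_eq_sum {n : ℕ} (S : Finset (Fin n)) (A : Set ℕ) (X : Fin n → ℕ) :
    hits S A X = ∑ j ∈ S, A.indicator (fun _ => (1 : ℝ)) (X j) := by
  classical
  simp only [hits, Set.indicator_apply, Finset.sum_boole]

lemma hits_nonneg {n : ℕ} (S : Finset (Fin n)) (A : Set ℕ) (X : Fin n → ℕ) : 0 ≤ hits S A X :=
  Nat.cast_nonneg _

lemma hits_le {n : ℕ} (S : Finset (Fin n)) (A : Set ℕ) (X : Fin n → ℕ) : hits S A X ≤ S.card :=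
  by classical exact Nat.cast_le.2 (Finset.card_filter_le _ _)

lemma integrable_law_of_bounded {n m : ℕ} {θ : Fin n → unitInterval} {f : (Fin n → ℕ) → ℝ}
    (C : ℝ) (h : ∀ X, |f X| ≤ C) : Integrable f (law n m θ) :=
  Integrable.of_bound (Measurable.of_discrete).aestronglyMeasurable C (Eventually.of_forall h)

lemma integral_law_eval (n m : ℕ) (θ : Fin n → unitInterval) (j : Fin n) (f : ℕ → ℝ) :
    ∫ X, f (X j) ∂(law n m θ) = ∫ k, f k ∂(binomial m (θ j)) := by
  have h := measurePreserving_eval (fun j => binomial m (θ j)) j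
  rw [← h.map_eq, integral_map (measurable_pi_apply j).aemeasurable
    (Measurable.of_discrete).aestronglyMeasurable]
  rfl

lemma integral_hits (n m : ℕ) (θ : Fin n → unitInterval) (S : Finset (Fin n)) (A : Set ℕ) :
    ∫ X, hits S A X ∂(law n m θ) = ∑ j ∈ S, (binomial m (θ j)).real A := by
  simp_rw [hits_eq_sum]
  rw [integral_finsetSum]
  · refine Finset.sum_congr rfl fun j _ => ?_
    rw [integral_law_eval n m θ j (A.indicator fun _ => (1 : ℝ)),
      integral_indicator_const _ MeasurableSet.of_discrete]
    simp
  · intro j _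
    refine integrable_law_of_bounded 1 fun X => ?_
    by_cases h : X j ∈ A <;> simp [h]

lemma law_real_hits_ge_le {n m : ℕ} (θ : Fin n → unitInterval) (S : Finset (Fin n)) (A : Set ℕ)
    {π c : ℝ} (hc : 0 < c) (hπ : ∀ j ∈ S, (binomial m (θ j)).real A ≤ π) :
    (law n m θ).real {X | c ≤ hits S A X} ≤ S.card * π / c := by
  have h := mul_meas_ge_le_integral_of_nonneg (μ := law n m θ) (f := hits S A)
    (Eventually.of_forall fun X => hits_nonneg S A X)
    (integrable_law_of_bounded S.card fun X => by
      rw [abs_of_nonneg (hits_nonneg S A X)]; exact hits_le S A X) c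
  rw [integral_hits] at h
  rw [le_div_iff₀ hc, mul_comm]
  refine h.trans ((Finset.sum_le_sum hπ).trans (le_of_eq ?_))
  simp

lemma variance_indicator_le {m : ℕ} (p : unitInterval) (A : Set ℕ) :
    variance (A.indicator fun _ => (1 : ℝ)) (binomial m p) ≤ (binomial m p).real A := by
  refine (variance_le_expectation_sq (Measurable.of_discrete).aestronglyMeasurable).trans
    (le_of_eq ?_)
  have : (A.indicator fun _ => (1 : ℝ)) ^ 2 = A.indicator fun _ => (1 : ℝ) := by
    ext k; by_cases h : k ∈ A <;> simp [h]
  rw [this, integral_indicator_const _ MeasurableSet.of_discrete]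
  simp

lemma variance_hits_le (n m : ℕ) (θ : Fin n → unitInterval) (S : Finset (Fin n)) (A : Set ℕ) :
    variance (hits S A) (law n m θ) ≤ ∑ j ∈ S, (binomial m (θ j)).real A := by
  classical
  -- The sum is padded by zero functions off `S` so that the variance formula for product measures
  -- applies.
  have e : hits S A = ∑ j : Fin n, fun X : Fin n → ℕ =>
      (if j ∈ S then A.indicator (fun _ => (1 : ℝ)) else 0) (X j) := by
    ext X
    rw [hits_eq_sum, Finset.sum_apply, ← Finset.sum_filter_add_sum_filter_not Finset.univ (· ∈ S)]
    rw [Finset.sum_congr (Finset.filter_univ_mem S).symm fun _ _ => rfl]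
    have h0 : ∑ x with x ∉ S, (if x ∈ S then A.indicator (fun _ => (1 : ℝ)) else 0) (X x) = 0 :=
      Finset.sum_eq_zero fun j hj => by simp [(Finset.mem_filter.1 hj).2]
    rw [h0, add_zero]
    exact Finset.sum_congr rfl fun j hj => by simp [(Finset.mem_filter.1 hj).2]
  rw [e, law, variance_sum_pi]
  · rw [← Finset.sum_subset (Finset.subset_univ S)]
    · exact Finset.sum_le_sum fun j hj => by
        simpa [hj] using variance_indicator_le (m := m) (θ j) A
    · intro j _ hj
      simp [hj]
  · intro j
    refine MemLp.of_bound (Measurable.of_discrete).aestronglyMeasurable 1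
      (Eventually.of_forall fun k => ?_)
    by_cases hj : j ∈ S <;> by_cases hk : k ∈ A <;> simp [hj, hk]

/-- Chebyshev: a sum of independent indicators is at least half its mean. -/
lemma law_real_hits_lt_le {n m : ℕ} (θ : Fin n → unitInterval) (S : Finset (Fin n)) (A : Set ℕ)
    {c : ℝ} (hc : 0 < c) (hS : 2 * c ≤ ∑ j ∈ S, (binomial m (θ j)).real A) :
    (law n m θ).real {X | hits S A X < c} ≤ 2 / c := by
  set M := ∑ j ∈ S, (binomial m (θ j)).real A with hM
  have hM0 : 0 < M := by linarith
  have hLp : MemLp (hits S A) 2 (law n m θ) :=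
    MemLp.of_bound (Measurable.of_discrete).aestronglyMeasurable S.card
      (Eventually.of_forall fun X => by
        rw [Real.norm_eq_abs, abs_of_nonneg (hits_nonneg S A X)]; exact hits_le S A X)
  have h := meas_ge_le_variance_div_sq hLp (c := M / 2) (by positivity)
  rw [integral_hits, ← hM] at h
  have h2 : (law n m θ).real {X | M / 2 ≤ |hits S A X - M|} ≤
      variance (hits S A) (law n m θ) / (M / 2) ^ 2 :=
    ENNReal.toReal_le_of_le_ofReal (div_nonneg (variance_nonneg _ _) (sq_nonneg _)) h
  refine (measureReal_mono (s₂ := {X | M / 2 ≤ |hits S A X - M|}) fun X hX => ?_).trans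
    (h2.trans ?_)
  · simp only [Set.mem_ofPred_eq] at hX ⊢
    rw [abs_sub_comm]
    exact le_trans (by linarith) (le_abs_self _)
  · rw [div_le_div_iff₀ (by positivity) hc]
    have hv := variance_hits_le n m θ S A
    rw [← hM] at hv
    nlinarith [mul_le_mul_of_nonneg_right hv hc.le]

/-! ### The dichotomy and the non-asymptotic risk bound. -/

/-- The counts at distance at least `u` from `m / 2` in direction `σ`. -/
def tail (m : ℕ) (σ u : ℝ) : Set ℕ := {k | u ≤ σ * ((k : ℝ) - m / 2)}

lemma fdp_nonneg {n : ℕ} (θ : Fin n → unitInterval) (R : Finset (Fin n)) : 0 ≤ fdp θ R := by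
  unfold fdp; positivity

lemma fnp_nonneg {n : ℕ} (θ : Fin n → unitInterval) (R : Finset (Fin n)) : 0 ≤ fnp θ R := by
  unfold fnp; positivity

lemma fdp_le_one {n : ℕ} (θ : Fin n → unitInterval) (R : Finset (Fin n)) : fdp θ R ≤ 1 := by
  refine div_le_one_of_le₀ ((Nat.cast_le.2 (Finset.card_le_card Finset.sdiff_subset)).trans
    (le_max_right _ _)) (by positivity)

lemma fnp_le_one {n : ℕ} (θ : Fin n → unitInterval) (R : Finset (Fin n)) : fnp θ R ≤ 1 := by
  refine div_le_one_of_le₀ ((Nat.cast_le.2 (Finset.card_le_card Finset.sdiff_subset)).trans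
    (le_max_right _ _)) (by positivity)

/-- Many false discoveries make the false discovery proportion large. -/
lemma fdp_ge {n : ℕ} {θ : Fin n → unitInterval} {R : Finset (Fin n)} {K : ℝ} (hK : 0 < K)
    (hs : 1 ≤ (support θ).card) (h : K * (support θ).card ≤ ((R \ support θ).card : ℝ)) :
    K / (K + 1) ≤ fdp θ R := by
  have hs' : (1 : ℝ) ≤ (support θ).card := by exact_mod_cast hs
  have hpos : (0 : ℝ) < (R \ support θ).card := lt_of_lt_of_le (by positivity) h
  have hR1 : (1 : ℝ) ≤ R.card := by
    have h1 : 1 ≤ (R \ support θ).card := by exact_mod_cast hpos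
    exact_mod_cast h1.trans (Finset.card_le_card Finset.sdiff_subset)
  have hR : (R.card : ℝ) ≤ (R \ support θ).card + (support θ).card := by
    have : R.card ≤ (R \ support θ).card + (support θ).card := by
      classical
      have := Finset.card_sdiff_add_card_inter R (support θ)
      have := Finset.card_le_card (Finset.inter_subset_right (s₁ := R) (s₂ := support θ))
      omega
    exact_mod_cast this
  rw [fdp, max_eq_right hR1, div_le_div_iff₀ (by linarith) (by linarith)]
  nlinarith [mul_le_mul_of_nonneg_left hR hK.le]

/-- The thresholding dichotomy. -/
lemma fdp_add_fnp_ge {n m : ℕ} {θ : Fin n → unitInterval} (T : ThresholdingProcedure n)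
    {X : Fin n → ℕ} {K ε u : ℝ} (hK : 0 < K) (hs : 1 ≤ (support θ).card)
    (hsig : ∀ σ : ℝ, σ = 1 ∨ σ = -1 →
      hits (support θ) (tail m σ u) X ≤ ε / 2 * (support θ).card)
    (hnull : ∀ σ : ℝ, σ = 1 ∨ σ = -1 →
      K * (support θ).card ≤ hits (Finset.univ \ support θ) (tail m σ u) X) :
    min (1 - ε) (K / (K + 1)) ≤ fdp θ (T.rejected m X) + fnp θ (T.rejected m X) := by
  classical
  have hs' : (1 : ℝ) ≤ (support θ).card := by exact_mod_cast hs
  have many : ∀ σ : ℝ, σ = 1 ∨ σ = -1 →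
      (∀ j, X j ∈ tail m σ u → j ∈ T.rejected m X) →
      min (1 - ε) (K / (K + 1)) ≤ fdp θ (T.rejected m X) + fnp θ (T.rejected m X) := by
    intro σ hσ hsub
    have h1 : K / (K + 1) ≤ fdp θ (T.rejected m X) := by
      refine fdp_ge hK hs ((hnull σ hσ).trans (Nat.cast_le.2 (Finset.card_le_card ?_)))
      intro j hj
      rw [Finset.mem_filter, Finset.mem_sdiff] at hj
      exact Finset.mem_sdiff.2 ⟨hsub j hj.2, hj.1.2⟩
    exact (min_le_right _ _).trans (by linarith [fnp_nonneg θ (T.rejected m X)])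
  by_cases h1 : (m : ℝ) * T.τ₁ X ≤ u
  · refine many 1 (Or.inl rfl) fun j hj => ?_
    simp only [tail, Set.mem_ofPred_eq, one_mul] at hj
    exact Finset.mem_filter.2 ⟨Finset.mem_univ _, Or.inl (h1.trans hj)⟩
  by_cases h2 : (m : ℝ) * T.τ₂ X ≤ u
  · refine many (-1) (Or.inr rfl) fun j hj => ?_
    simp only [tail, Set.mem_ofPred_eq] at hj
    exact Finset.mem_filter.2 ⟨Finset.mem_univ _, Or.inr (by linarith)⟩
  -- Both thresholds now exceed `u`, so each rejected signal lies beyond `u` on one side, and each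
  -- side contributes at most `ε / 2` of the signals.
  push Not at h1 h2
  refine (min_le_left _ _).trans ?_
  have hsubset : support θ ∩ T.rejected m X ⊆
      ((support θ).filter fun j => X j ∈ tail m 1 u) ∪
        ((support θ).filter fun j => X j ∈ tail m (-1) u) := by
    intro j hj
    rw [Finset.mem_inter] at hj
    rw [Finset.mem_union, Finset.mem_filter, Finset.mem_filter]
    rcases (Finset.mem_filter.1 hj.2).2 with h | h
    · left; refine ⟨hj.1, ?_⟩
      simp only [tail, Set.mem_ofPred_eq, one_mul]; linarith
    · right; refine ⟨hj.1, ?_⟩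
      simp only [tail, Set.mem_ofPred_eq]; linarith
  have hcard : ((support θ ∩ T.rejected m X).card : ℝ) ≤ ε * (support θ).card := by
    have h3 : ((support θ ∩ T.rejected m X).card : ℝ) ≤
        hits (support θ) (tail m 1 u) X + hits (support θ) (tail m (-1) u) X := by
      have := (Finset.card_le_card hsubset).trans (Finset.card_union_le _ _)
      refine (Nat.cast_le.2 this).trans (le_of_eq ?_)
      rw [Nat.cast_add]
      rfl
    have h4 := hsig 1 (Or.inl rfl)
    have h5 := hsig (-1) (Or.inr rfl)
    linarith
  have hsplit : ((support θ \ T.rejected m X).card : ℝ) +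
      (support θ ∩ T.rejected m X).card = (support θ).card := by
    exact_mod_cast Finset.card_sdiff_add_card_inter (support θ) (T.rejected m X)
  have hf : 1 - ε ≤ fnp θ (T.rejected m X) := by
    rw [fnp, max_eq_right hs', le_div_iff₀ (by linarith)]
    linarith
  linarith [fdp_nonneg θ (T.rejected m X)]

/-- Non-asymptotic lower bound for the risk of every thresholding procedure. -/
lemma risk_ge {n m : ℕ} {θ : Fin n → unitInterval} (T : ThresholdingProcedure n)
    {K ε u π p : ℝ} (hK : 0 < K) (hε : 0 < ε) (hε1 : ε ≤ 1) (hs : 1 ≤ (support θ).card)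
    (hsig : ∀ σ : ℝ, σ = 1 ∨ σ = -1 → ∀ j ∈ support θ, (binomial m (θ j)).real (tail m σ u) ≤ π)
    (hnull : ∀ σ : ℝ, σ = 1 ∨ σ = -1 → p ≤ (binomial m unitHalf).real (tail m σ u))
    {c : ℝ} (hc : 0 < c) (hKc : K * (support θ).card ≤ c)
    (hp : 2 * c ≤ ((n : ℝ) - (support θ).card) * p) :
    min (1 - ε) (K / (K + 1)) * (1 - (4 * π / ε + 4 / c)) ≤ risk m θ T := by
  classical
  set μ := law n m θ with hμ
  set s : ℝ := ((support θ).card : ℝ) with hsdef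
  have hs' : (1 : ℝ) ≤ s := by rw [hsdef]; exact_mod_cast hs
  let S' : Finset (Fin n) := Finset.univ \ support θ
  have hS'card : (S'.card : ℝ) = n - s := by
    have h := Finset.card_sdiff_add_card_eq_card (Finset.subset_univ (support θ))
    rw [Finset.card_univ, Fintype.card_fin] at h
    rw [hsdef, eq_sub_iff_add_eq]; exact_mod_cast h
  let Bs : ℝ → Set (Fin n → ℕ) := fun σ => {X | ε / 2 * s ≤ hits (support θ) (tail m σ u) X}
  let Bn : ℝ → Set (Fin n → ℕ) := fun σ => {X | hits S' (tail m σ u) X < c}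
  have hBs : ∀ σ : ℝ, σ = 1 ∨ σ = -1 → μ.real (Bs σ) ≤ 2 * π / ε := by
    intro σ hσ
    refine (law_real_hits_ge_le θ (support θ) (tail m σ u) (by positivity)
      (hsig σ hσ)).trans (le_of_eq ?_)
    rw [← hsdef]; field_simp
  have hBn : ∀ σ : ℝ, σ = 1 ∨ σ = -1 → μ.real (Bn σ) ≤ 2 / c := by
    intro σ hσ
    refine law_real_hits_lt_le θ S' (tail m σ u) hc (hp.trans ?_)
    rw [← hS'card, ← nsmul_eq_mul]
    refine Finset.card_nsmul_le_sum S' _ p fun j hj => ?_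
    have hj' : θ j = unitHalf := by
      have := (Finset.mem_sdiff.1 hj).2
      simp only [support, Finset.mem_filter, Finset.mem_univ, true_and, not_not] at this
      exact Subtype.ext this
    rw [hj']; exact hnull σ hσ
  -- Off this event the dichotomy applies whatever thresholds the data select.
  let B := (Bs 1 ∪ Bs (-1)) ∪ (Bn 1 ∪ Bn (-1))
  have hB : μ.real B ≤ 4 * π / ε + 4 / c := by
    have e1 := measureReal_union_le (μ := μ) (Bs 1 ∪ Bs (-1)) (Bn 1 ∪ Bn (-1))
    have e2 := measureReal_union_le (μ := μ) (Bs 1) (Bs (-1))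
    have e3 := measureReal_union_le (μ := μ) (Bn 1) (Bn (-1))
    have e4 := hBs 1 (Or.inl rfl)
    have e5 := hBs (-1) (Or.inr rfl)
    have e6 := hBn 1 (Or.inl rfl)
    have e7 := hBn (-1) (Or.inr rfl)
    have e8 : 4 * π / ε + 4 / c = 2 * π / ε + 2 * π / ε + (2 / c + 2 / c) := by ring
    rw [e8]
    exact e1.trans (by linarith)
  have hBc : 1 - (4 * π / ε + 4 / c) ≤ μ.real Bᶜ := by
    rw [probReal_compl_eq_one_sub MeasurableSet.of_discrete]; linarith
  set ρ := min (1 - ε) (K / (K + 1)) with hρ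
  have hρ0 : 0 ≤ ρ := le_min (by linarith) (by positivity)
  have hfd : Integrable (fun X => fdp θ (T.rejected m X)) μ :=
    integrable_law_of_bounded 1 fun X => by
      rw [abs_of_nonneg (fdp_nonneg _ _)]; exact fdp_le_one _ _
  have hfn : Integrable (fun X => fnp θ (T.rejected m X)) μ :=
    integrable_law_of_bounded 1 fun X => by
      rw [abs_of_nonneg (fnp_nonneg _ _)]; exact fnp_le_one _ _
  have hrisk : risk m θ T =
      ∫ X, (fdp θ (T.rejected m X) + fnp θ (T.rejected m X)) ∂μ := by
    rw [risk, fdr, fnr, integral_add hfd hfn]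
  rw [hrisk]
  have hind : ∫ X, Bᶜ.indicator (fun _ => ρ) X ∂μ = μ.real Bᶜ * ρ := by
    rw [integral_indicator_const _ MeasurableSet.of_discrete, smul_eq_mul]
  calc ρ * (1 - (4 * π / ε + 4 / c)) ≤ ρ * μ.real Bᶜ := mul_le_mul_of_nonneg_left hBc hρ0
    _ = ∫ X, Bᶜ.indicator (fun _ => ρ) X ∂μ := by rw [hind, mul_comm]
    _ ≤ _ := by
        refine integral_mono ((integrable_const ρ).indicator MeasurableSet.of_discrete)
          (hfd.add hfn) fun X => ?_
        by_cases hX : X ∈ Bᶜ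
        · rw [Set.indicator_of_mem hX]
          simp only [B, Bs, Bn, Set.mem_compl_iff, Set.mem_union, Set.mem_ofPred_eq, not_or,
            not_le, not_lt] at hX
          obtain ⟨⟨a1, a2⟩, a3, a4⟩ := hX
          refine fdp_add_fnp_ge T (u := u) hK hs ?_ ?_
          · rintro σ (rfl | rfl)
            exacts [a1.le, a2.le]
          · rintro σ (rfl | rfl)
            exacts [hKc.trans a3, hKc.trans a4]
        · rw [Set.indicator_of_notMem hX]
          exact add_nonneg (fdp_nonneg _ _) (fnp_nonneg _ _)

end BernoulliSequence

/-! ### Calibration of the constants. -/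

namespace BernoulliSequence

lemma zeta_sq_eq_log_div {n m s : ℕ} (hL : 0 ≤ Real.log ((n : ℝ) / s)) :
    zeta m ((s : ℝ) / n) ^ 2 = Real.log ((n : ℝ) / s) / (2 * m) := by
  rw [zeta, one_div_div, Real.sq_sqrt (by positivity)]
  ring

/-- The tilting exponent is smaller than `log (n / s)` for a suitable relative margin. -/
lemma exists_tilt_margin {b : ℝ} (hb0 : 0 < b) (hb1 : b < 1) :
    ∃ η κ δ : ℝ, 0 < η ∧ η < 1 ∧ κ < 1 ∧ 0 < δ ∧ ∀ x, 0 ≤ x → x < δ →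
      x < 1 / 2 ∧ (b / (1 - η)) ^ 2 * (2 * (1 + η) / (1 - 2 * x) - 1) ≤ κ := by
  -- `g (η, x)` is the tilting exponent divided by `L`. Its value at the origin is `b² < 1`, so
  -- continuity keeps it below the midpoint `(1 + b²) / 2`, which serves as `κ`.
  let g : ℝ × ℝ → ℝ := fun z => (b / (1 - z.1)) ^ 2 * (2 * (1 + z.1) / (1 - 2 * z.2) - 1)
  have hg : ContinuousAt g (0, 0) := by
    refine ContinuousAt.mul (ContinuousAt.pow (ContinuousAt.div (by fun_prop) (by fun_prop)
      (by norm_num)) 2) (ContinuousAt.sub (ContinuousAt.div (by fun_prop) (by fun_prop)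
      (by norm_num)) (by fun_prop))
  have hb2 : b ^ 2 < 1 := by nlinarith
  have hg0 : g (0, 0) < (1 + b ^ 2) / 2 := by
    simp only [g]; norm_num; linarith
  have hev := hg.eventually_lt continuousAt_const hg0
  obtain ⟨δ, hδ, hball⟩ := Metric.eventually_nhds_iff.1 hev
  have hmin : 0 < min δ (1 / 2) := lt_min hδ (by norm_num)
  have h1 := min_le_left δ (1 / 2)
  have h2 := min_le_right δ (1 / 2)
  refine ⟨min δ (1 / 2) / 2, (1 + b ^ 2) / 2, min δ (1 / 2), by linarith, by linarith, by linarith,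
    hmin, fun x hx hxδ => ⟨by linarith, ?_⟩⟩
  refine (hball (y := (min δ (1 / 2) / 2, x)) ?_).le
  rw [Prod.dist_eq, Real.dist_eq, Real.dist_eq]
  simp only [sub_zero]
  rw [abs_of_nonneg hx, abs_of_pos (by linarith)]
  exact max_lt (by linarith) (by linarith)

set_option maxHeartbeats 800000 in
/-- Uniform lower bound for the risk over small signals, in terms of the size of `log (n / s)`
and of `ζ`. -/
lemma exists_risk_ge {a ε : ℝ} (ha0 : 0 < a) (ha1 : a < 1) (hε : 0 < ε) (hε2 : ε ≤ 1 / 2) :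
    ∃ L₀ δ : ℝ, 0 < δ ∧ ∀ (n m s : ℕ) (θ : Fin n → unitInterval),
      θ ∈ smallSignals n s (a * zeta m ((s : ℝ) / n)) → 0 < m → 1 ≤ s →
      L₀ ≤ Real.log ((n : ℝ) / s) → zeta m ((s : ℝ) / n) < δ →
      ∀ T : ThresholdingProcedure n, (1 - ε) * (1 - 2 * ε) ≤ risk m θ T := by
  have hε1 : ε ≤ 1 := by linarith
  obtain ⟨b, hab, hb1⟩ := exists_between ha1
  have hb0 : 0 < b := ha0.trans hab
  obtain ⟨η, κ, δ, hη0, hη1, hκ1, hδ, hmargin⟩ := exists_tilt_margin hb0 hb1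
  have h1η : 0 < 1 - η := by linarith
  have h1κ : 0 < 1 - κ := by linarith
  have hba : 0 < b - a := by linarith
  -- In order: positivity; the Chebyshev window `m c² ≥ 1` with `c = η x`; signal crossing
  -- probability at most `ε² / 4`; at least half of the coordinates null; at least `8 s / ε`
  -- expected null crossings.
  have hev : ∀ᶠ L : ℝ in atTop, 1 ≤ L ∧ 1 ≤ (η * b / (1 - η)) ^ 2 / 2 * L ∧
      2 / (ε ^ 2 * (b - a) ^ 2) ≤ L ∧ 2 ≤ Real.exp L ∧
      64 / (3 * ε) ≤ Real.exp ((1 - κ) * L) := by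
    have hmulT : Tendsto (fun L : ℝ => (η * b / (1 - η)) ^ 2 / 2 * L) atTop atTop :=
      tendsto_id.const_mul_atTop (by positivity)
    have hexpT : Tendsto (fun L : ℝ => Real.exp ((1 - κ) * L)) atTop atTop :=
      Real.tendsto_exp_atTop.comp (tendsto_id.const_mul_atTop h1κ)
    exact (eventually_ge_atTop 1).and ((hmulT.eventually_ge_atTop 1).and
      ((eventually_ge_atTop _).and ((Real.tendsto_exp_atTop.eventually_ge_atTop 2).and
        (hexpT.eventually_ge_atTop _))))
  obtain ⟨L₀, hL₀⟩ := eventually_atTop.1 hev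
  refine ⟨L₀, δ * (1 - η) / b, by positivity, fun n m s θ hθ hm hs hL hζ T => ?_⟩
  obtain ⟨-, hsmall, hcard⟩ := hθ
  set L := Real.log ((n : ℝ) / s) with hLdef
  obtain ⟨hL1, hLc, hLπ, hL2, hLK⟩ := hL₀ L hL
  set z := zeta m ((s : ℝ) / n) with hz
  have hm' : (0 : ℝ) < m := by exact_mod_cast hm
  have hs' : (1 : ℝ) ≤ s := by exact_mod_cast hs
  have hz2 : z ^ 2 = L / (2 * m) := zeta_sq_eq_log_div (by linarith)
  have hmz : m * z ^ 2 = L / 2 := by rw [hz2]; field_simp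
  have hz0 : 0 < z := by
    have h1 : 0 ≤ z := Real.sqrt_nonneg _
    have h2 : 0 < z ^ 2 := by rw [hz2]; positivity
    exact lt_of_le_of_ne h1 fun h => by rw [← h] at h2; norm_num at h2
  have hnpos : (0 : ℝ) < n := by
    rcases (Nat.cast_nonneg (α := ℝ) n).eq_or_lt with h | h
    · rw [hLdef, ← h] at hL1; norm_num at hL1
    · exact h
  have hn : (n : ℝ) = s * Real.exp L := by
    rw [hLdef, Real.exp_log (by positivity)]; field_simp
  -- Chosen so that the lower edge `x - η x` of the tilting window is exactly `b z`.
  set x := b * z / (1 - η) with hx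
  have hx0 : 0 ≤ x := by positivity
  have hxδ : x < δ := by
    rw [hx, div_lt_iff₀ h1η, mul_comm b z, ← lt_div_iff₀ hb0]; exact hζ
  obtain ⟨hx2, hκ⟩ := hmargin x hx0 hxδ
  have hxpos : 0 < x := by positivity
  have hxη : x - η * x = b * z := by rw [hx]; field_simp
  have hmx : m * x ^ 2 = (b / (1 - η)) ^ 2 * (L / 2) := by
    rw [← hmz, hx]; ring
  have hmc : 1 ≤ m * (η * x) ^ 2 := by
    refine hLc.trans (le_of_eq ?_)
    rw [mul_pow, mul_left_comm, hmx]; ring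
  have hexp : m * (4 * (x + η * x) * x / (1 - 2 * x) - 2 * x ^ 2) ≤ κ * L := by
    have e : m * (4 * (x + η * x) * x / (1 - 2 * x) - 2 * x ^ 2) =
        (m * x ^ 2) * (2 * (2 * (1 + η) / (1 - 2 * x) - 1)) := by ring
    rw [e, hmx]
    refine le_trans (le_of_eq ?_) (mul_le_mul_of_nonneg_right hκ (by linarith : (0 : ℝ) ≤ L))
    ring
  have hnull : ∀ σ : ℝ, σ = 1 ∨ σ = -1 →
      3 / 4 * Real.exp (-(κ * L)) ≤ (binomial m unitHalf).real (tail m σ (m * (b * z))) := by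
    intro σ hσ
    have h := binomial_half_tail_ge (m := m) hσ (c := η * x) (by positivity) hx0 hx2 hmc
    rw [hxη] at h
    refine le_trans ?_ h
    have := Real.exp_le_exp.2 (neg_le_neg hexp)
    linarith
  have hsig : ∀ σ : ℝ, σ = 1 ∨ σ = -1 → ∀ j ∈ support θ,
      (binomial m (θ j)).real (tail m σ (m * (b * z))) ≤ ε ^ 2 / 4 := by
    intro σ hσ j hj
    refine (binomial_tail_le hσ hm (d := a * z) (t := b * z)
      (mul_lt_mul_of_pos_right hab hz0) (θ j) (hsmall j hj)).trans ?_
    have e : 4 * (m * (b * z - a * z) ^ 2) = 2 * (b - a) ^ 2 * L := by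
      rw [show m * (b * z - a * z) ^ 2 = (b - a) ^ 2 * (m * z ^ 2) by ring, hmz]; ring
    rw [e, div_le_div_iff₀ (by positivity) (by norm_num)]
    rw [div_le_iff₀ (by positivity)] at hLπ
    have e' : ε ^ 2 * (2 * (b - a) ^ 2 * L) = 2 * (L * (ε ^ 2 * (b - a) ^ 2)) := by ring
    rw [e']; linarith
  -- With `K = 4 / ε` and `c = K s`, the FDP bound `K / (K + 1)` is at least `1 - ε` and the failure
  -- probability is at most `ε + ε / s`.
  have hK : (0 : ℝ) < 4 / ε := by positivity
  have hp : 2 * (4 / ε * s) ≤ ((n : ℝ) - (support θ).card) * (3 / 4 * Real.exp (-(κ * L))) := by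
    rw [hcard]
    have h1 : (n : ℝ) / 2 ≤ n - s := by
      have := mul_le_mul_of_nonneg_left hL2 (by linarith : (0 : ℝ) ≤ s)
      rw [hn]; linarith
    have h2 : (n : ℝ) * Real.exp (-(κ * L)) = s * Real.exp ((1 - κ) * L) := by
      rw [hn, mul_assoc, ← Real.exp_add]; congr 2; ring
    have h3 : s * (64 / (3 * ε)) ≤ s * Real.exp ((1 - κ) * L) :=
      mul_le_mul_of_nonneg_left hLK (by linarith)
    have h4 := mul_le_mul_of_nonneg_right h1 (Real.exp_pos (-(κ * L))).le
    have h5 : 2 * (4 / ε * s) = 3 / 8 * (s * (64 / (3 * ε))) := by field_simp; norm_num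
    have h6 : (n : ℝ) / 2 * Real.exp (-(κ * L)) = 1 / 2 * (s * Real.exp ((1 - κ) * L)) := by
      rw [← h2]; ring
    rw [h6] at h4
    rw [h5, mul_left_comm]
    linarith
  have hr := risk_ge (m := m) (θ := θ) T (u := m * (b * z)) (c := 4 / ε * s) hK hε hε1
    (by rw [hcard]; exact hs) hsig hnull (by positivity) (by rw [hcard]) hp
  refine le_trans ?_ hr
  have hmin : 1 - ε ≤ min (1 - ε) (4 / ε / (4 / ε + 1)) := by
    refine le_min le_rfl ?_
    have : 4 / ε / (4 / ε + 1) = 4 / (4 + ε) := by field_simp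
    rw [this, le_div_iff₀ (by positivity)]
    nlinarith
  have hfail : 4 * (ε ^ 2 / 4) / ε + 4 / (4 / ε * s) ≤ 2 * ε := by
    have e1 : 4 * (ε ^ 2 / 4) / ε = ε := by field_simp
    have e2 : 4 / (4 / ε * s) = ε / s := by field_simp
    rw [e1, e2]
    linarith [div_le_self hε.le hs']
  exact mul_le_mul hmin (by linarith) (by linarith) (le_trans (by linarith) hmin)

/-- A configuration whose nonzero signals all lie at distance exactly `d` above `1/2`. -/
lemma exists_signal_exactly {n s : ℕ} (hsn : s ≤ n) {d : ℝ} (hd0 : 0 < d) (hd : d ≤ 1 / 2) :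
    ∃ θ : Fin n → unitInterval, (support θ).card = s ∧
      ∀ j ∈ support θ, |(θ j : ℝ) - 1 / 2| = d := by
  classical
  obtain ⟨S, -, hS⟩ := Finset.exists_subset_card_eq
    (s := (Finset.univ : Finset (Fin n))) (n := s) (by simpa using hsn)
  let q : unitInterval := ⟨1 / 2 + d, by constructor <;> linarith⟩
  have hq : (q : ℝ) = 1 / 2 + d := rfl
  let θ : Fin n → unitInterval := fun j => if j ∈ S then q else unitHalf
  have hsupp : support θ = S := by
    ext j
    simp only [support, Finset.mem_filter, Finset.mem_univ, true_and, θ]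
    by_cases hj : j ∈ S
    · simp only [hj, if_true, iff_true, hq]; linarith
    · simp [hj, unitHalf]
  refine ⟨θ, by rw [hsupp, hS], fun j hj => ?_⟩
  rw [hsupp] at hj
  simp only [θ, hj, if_true, hq]
  rw [add_sub_cancel_left, abs_of_pos hd0]

end BernoulliSequence

/-! ### Passage to the limit. -/

theorem mainTheorem7 (s m : ℕ → ℕ) (v₁ a : ℝ)
    (hv₀ : 0 < v₁) (hv₁ : v₁ < 1)
    (hs_pos : ∀ᶠ n in atTop, 1 ≤ s n)
    (hs : ∀ᶠ n : ℕ in atTop, (s n : ℝ) ≤ (n : ℝ) ^ v₁)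
    (hm : (fun n : ℕ => (Real.log (n : ℝ)) ^ 2) =o[atTop] (fun n : ℕ => (m n : ℝ)))
    (ha₀ : 0 < a) (ha₁ : a < 1) :
    (1 : EReal) ≤ liminf (fun n : ℕ =>
        ⨅ T : BernoulliSequence.ThresholdingProcedure n,
          ⨆ θ ∈ BernoulliSequence.largeSignals n (m n) (s n) a,
            ((BernoulliSequence.risk (m n) θ T : ℝ) : EReal)) atTop ∧
    (1 : EReal) ≤ liminf (fun n : ℕ =>
        ⨅ T : BernoulliSequence.ThresholdingProcedure n,
          ⨅ θ ∈ BernoulliSequence.smallSignals n (s n)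
              (a * BernoulliSequence.zeta (m n) ((s n : ℝ) / n)),
            ((BernoulliSequence.risk (m n) θ T : ℝ) : EReal)) atTop := by
  have hlog : Tendsto (fun n : ℕ => Real.log (n : ℝ)) atTop atTop :=
    Real.tendsto_log_atTop.comp tendsto_natCast_atTop_atTop
  have hL : ∀ᶠ n : ℕ in atTop, (1 - v₁) * Real.log n ≤ Real.log ((n : ℝ) / s n) ∧
      Real.log ((n : ℝ) / s n) ≤ Real.log n := by
    filter_upwards [hs_pos, hs, eventually_ge_atTop 1] with n h1 h2 h3
    have hn : (0 : ℝ) < n := by exact_mod_cast h3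
    have hsn : (1 : ℝ) ≤ s n := by exact_mod_cast h1
    have hs0 : (0 : ℝ) < s n := by linarith
    have h4 := Real.log_le_log hs0 h2
    rw [Real.log_rpow hn] at h4
    have h5 := Real.log_nonneg hsn
    rw [Real.log_div hn.ne' hs0.ne']
    constructor <;> linarith
  have hLT : Tendsto (fun n : ℕ => Real.log ((n : ℝ) / s n)) atTop atTop :=
    tendsto_atTop_mono' atTop (hL.mono fun n h => h.1)
      (hlog.const_mul_atTop (sub_pos.2 hv₁))
  have hmlog : ∀ c : ℝ, 0 < c → ∀ᶠ n : ℕ in atTop, Real.log n ^ 2 ≤ c * m n := by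
    intro c hc
    filter_upwards [hm.bound hc] with n hn
    simpa using hn
  have hm0 : ∀ᶠ n : ℕ in atTop, 0 < m n := by
    filter_upwards [hmlog 1 one_pos, hlog.eventually_gt_atTop 0] with n h1 h2
    have : (0 : ℝ) < m n := by nlinarith
    exact_mod_cast this
  -- Once `log n ≥ 1`, `2 m ζ² ≤ log n ≤ (log n)² ≤ δ² m`.
  have hζ : ∀ δ : ℝ, 0 < δ → ∀ᶠ n : ℕ in atTop,
      BernoulliSequence.zeta (m n) ((s n : ℝ) / n) < δ := by
    intro δ hδ
    filter_upwards [hmlog (δ ^ 2) (by positivity), hlog.eventually_ge_atTop 1, hL, hm0,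
      hLT.eventually_ge_atTop 0] with n h1 h2 h3 h4 h5
    have hm' : (0 : ℝ) < m n := by exact_mod_cast h4
    refine lt_of_pow_lt_pow_left₀ 2 hδ.le ?_
    rw [BernoulliSequence.zeta_sq_eq_log_div h5, div_lt_iff₀ (by positivity)]
    nlinarith [mul_pos (pow_pos hδ 2) hm']
  have hrisk : ∀ r : ℝ, r < 1 → ∀ᶠ n : ℕ in atTop,
      ∀ (T : BernoulliSequence.ThresholdingProcedure n),
        ∀ θ ∈ BernoulliSequence.smallSignals n (s n)
          (a * BernoulliSequence.zeta (m n) ((s n : ℝ) / n)), r ≤ BernoulliSequence.risk (m n) θ T := by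
    intro r hr
    -- Since `(1 - ε) (1 - 2 ε) ≥ 1 - 3 ε`, taking `ε ≤ (1 - r) / 3` gives at least `r`.
    have hε : 0 < min ((1 - r) / 3) (1 / 2) := lt_min (by linarith) (by norm_num)
    have h1 := min_le_left ((1 - r) / 3) (1 / 2)
    have h2 := min_le_right ((1 - r) / 3) (1 / 2)
    obtain ⟨L₀, δ, hδ, h⟩ := BernoulliSequence.exists_risk_ge ha₀ ha₁ hε h2
    filter_upwards [hm0, hs_pos, hLT.eventually_ge_atTop L₀, hζ δ hδ] with n h3 h4 h5 h6 T θ hθ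
    refine le_trans ?_ (h n (m n) (s n) θ hθ h3 h4 h5 h6 T)
    nlinarith
  constructor
  · rw [← EReal.ge_of_forall_gt_iff_ge]
    intro r hr
    have hr' : r < 1 := by exact_mod_cast hr
    refine le_liminf_of_le (by isBoundedDefault) ?_
    filter_upwards [hrisk r hr', hζ (1 / 2) (by norm_num), hLT.eventually_gt_atTop 0, hm0,
      hs_pos] with n h1 h2 h3 h4 h5
    have hm' : (0 : ℝ) < m n := by exact_mod_cast h4
    have hs' : (0 : ℝ) < s n := by exact_mod_cast h5
    set z := BernoulliSequence.zeta (m n) ((s n : ℝ) / n) with hz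
    have hz0 : 0 < z := by
      have e1 : 0 ≤ z := Real.sqrt_nonneg _
      have e2 : 0 < z ^ 2 := by
        rw [hz, BernoulliSequence.zeta_sq_eq_log_div h3.le]; positivity
      exact lt_of_le_of_ne e1 fun h => by rw [← h] at e2; norm_num at e2
    have hsn : s n ≤ n := by
      by_contra hlt
      push Not at hlt
      have : (n : ℝ) / s n ≤ 1 := by
        rw [div_le_one hs']; exact_mod_cast hlt.le
      exact absurd (Real.log_nonpos (by positivity) this) (not_le.2 h3)
    -- This boundary configuration witnesses the supremum and obeys the small-signal bound; `ζ <
    -- 1/2` keeps it inside the unit interval.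
    obtain ⟨θ, hcard, hθ⟩ := BernoulliSequence.exists_signal_exactly hsn
      (d := a * z) (by positivity) (by nlinarith)
    refine le_iInf fun T => le_iSup₂_of_le θ ⟨hcard.le, fun j hj => (hθ j hj).ge, hcard⟩ ?_
    exact_mod_cast h1 T θ ⟨hcard.le, fun j hj => (hθ j hj).le, hcard⟩
  · rw [← EReal.ge_of_forall_gt_iff_ge]
    intro r hr
    have hr' : r < 1 := by exact_mod_cast hr
    refine le_liminf_of_le (by isBoundedDefault) ?_
    filter_upwards [hrisk r hr'] with n h1
    exact le_iInf fun T => le_iInf₂ fun θ hθ => by exact_mod_cast h1 T θ hθ
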